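/- Let $H$ be a complex Hilbert space and let $\mathbb{B}(H)$ be the algebra of bounded linear operators on $H$. For $S\in\mathbb{B}(H)$ let $\|S\|$ be the operator norm, $|S|=(S^*S)^{1/2}$, and let $w(S)=\sup\{|\langle Sx,x\rangle| : x\in H,\ \|x\|=1\}$ be the numerical radius (with $w(S)=0$ if $H=\{0\}$). Let $T\in\mathbb{B}(H)$ and $0\le t\le 1$, and put $$Q_t=|T^*|^{2(1-t)}+|T|^{2t},$$ where powers of positive operators are defined by the continuous functional calculus, with $A^0=I$. Then $$w(T)\le\sqrt{\tfrac1{16}\|Q_t\|^2+\tfrac14 w(T)^2+\tfrac18 w(TQ_t+Q_tT)}\le\tfrac14\|Q_t\|+\tfrac12 w(T)\le\tfrac12\|Q_t\|.$$ -/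

import Mathlib

/-- The numerical radius `w(T) = sup {|⟨T x, x⟩| : ‖x‖ = 1}` of a bounded operator. -/
noncomputable def numericalRadius {H : Type*} [NormedAddCommGroup H] [InnerProductSpace ℂ H]
    (T : H →L[ℂ] H) : ℝ :=
  sSup {r : ℝ | ∃ x : H, ‖x‖ = 1 ∧ r = ‖inner ℂ (T x) x‖}

/-- The set in the definition of the numerical radius is bounded above, so that the real
supremum is a genuine one whenever the space is nontrivial. -/
theorem numericalRadius_bddAbove {H : Type*} [NormedAddCommGroup H] [InnerProductSpace ℂ H]
    (T : H →L[ℂ] H) : BddAbove {r : ℝ | ∃ x : H, ‖x‖ = 1 ∧ r = ‖inner ℂ (T x) x‖} := by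
  refine ⟨‖T‖, ?_⟩
  rintro r ⟨x, hx, rfl⟩
  calc ‖inner ℂ (T x) x‖ ≤ ‖T x‖ * ‖x‖ := norm_inner_le_norm _ _
    _ ≤ ‖T‖ := by simpa [hx] using T.le_opNorm x

/-- `Q_t = |T*| ^ (2 (1 - t)) + |T| ^ (2 t)`. Here `CFC.abs S = (S* S) ^ (1/2)`, and the real powers
are those of the continuous functional calculus for positive operators, with `A ^ 0 = 1`. -/
noncomputable def operatorQ {H : Type*} [NormedAddCommGroup H] [InnerProductSpace ℂ H]
    [CompleteSpace H] (T : H →L[ℂ] H) (t : ℝ) : H →L[ℂ] H :=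
  CFC.rpow (CFC.abs (ContinuousLinearMap.adjoint T)) (2 * (1 - t)) + CFC.rpow (CFC.abs T) (2 * t)

/-!
If `p` is positive and invertible, expanding `0 ≤ (p - a) p⁻¹ (p - a)*` gives
`a + a* ≤ p + a p⁻¹ a*`. For `p = (a* a + ε) ^ t`, the intertwining relation
`a f(a* a) = f(a a*) a` bounds the last term by `(a a* + ε) ^ (1 - t)`, and `ε → 0` yields
`a + a* ≤ (a* a) ^ t + (a a*) ^ (1 - t)`. The right-hand side is unchanged when `a` is multiplied
by a unimodular scalar, so `2 Re (c T) ≤ Q_t` for all `|c| = 1`.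

Since `w(T)` is the supremum of `‖Re (c T)‖` over `|c| = 1`, it then suffices to bound the norm of
the right-hand side of `4 Re (c T) ≤ 2 Re (c T) + Q_t`; by the C⋆-identity its square is the norm of
`4 Re (c T) ^ 2 + Q_t ^ 2 + 2 Re (c (T Q_t + Q_t T))`.
-/

open Filter Topology
open scoped ComplexStarModule

section Intertwining

variable {𝕜 A : Type*} [RCLike 𝕜] {p : A → Prop} [Ring A] [StarRing A] [Algebra 𝕜 A]
  [TopologicalSpace A] [IsSemitopologicalRing A] [T2Space A] [ContinuousFunctionalCalculus 𝕜 A p]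

theorem semiconjBy_cfcHomSuperset {x a b : A} (ha : p a) (hb : p b) {s : Set 𝕜} [CompactSpace s]
    (hsa : spectrum 𝕜 a ⊆ s) (hsb : spectrum 𝕜 b ⊆ s) (h : SemiconjBy x a b)
    (hstar : SemiconjBy x (star a) (star b)) (f : C(s, 𝕜)) :
    SemiconjBy x (cfcHomSuperset ha hsa f) (cfcHomSuperset hb hsb f) := by
  induction f using ContinuousMap.induction_on_of_compact with
  | const r =>
    change SemiconjBy x (cfcHomSuperset ha hsa (algebraMap 𝕜 _ r))
      (cfcHomSuperset hb hsb (algebraMap 𝕜 _ r))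
    rw [AlgHomClass.commutes, AlgHomClass.commutes]
    exact Algebra.commute_algebraMap_right r x
  | id => simpa only [cfcHomSuperset_id] using h
  | star_id => simpa only [map_star, cfcHomSuperset_id] using hstar
  | add f g hf hg => simpa only [map_add] using hf.add_right hg
  | mul f g hf hg => simpa only [map_mul] using hf.mul_right hg
  | frequently f hf =>
    have hclosed : IsClosed
        {f : C(s, 𝕜) | SemiconjBy x (cfcHomSuperset ha hsa f) (cfcHomSuperset hb hsb f)} :=
      isClosed_eq ((cfcHomSuperset_continuous ha hsa).const_mul x)
        ((cfcHomSuperset_continuous hb hsb).mul_const x)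
    exact hclosed.mem_of_frequently_of_tendsto hf tendsto_id

theorem semiconjBy_cfc {x a b : A} (ha : p a) (hb : p b) (h : SemiconjBy x a b)
    (hstar : SemiconjBy x (star a) (star b)) {f : 𝕜 → 𝕜}
    (hf : ContinuousOn f (spectrum 𝕜 a ∪ spectrum 𝕜 b)) :
    SemiconjBy x (cfc f a) (cfc f b) := by
  have : CompactSpace ↑(spectrum 𝕜 a ∪ spectrum 𝕜 b) := isCompact_iff_compactSpace.mp <|
    (ContinuousFunctionalCalculus.isCompact_spectrum a).union
      (ContinuousFunctionalCalculus.isCompact_spectrum b)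
  rw [cfc_apply f a ha (hf.mono Set.subset_union_left),
    cfc_apply f b hb (hf.mono Set.subset_union_right)]
  exact semiconjBy_cfcHomSuperset ha hb Set.subset_union_left Set.subset_union_right h hstar
    ⟨_, hf.domRestrict⟩

end Intertwining

theorem add_star_le_add_mul_mul_star {R : Type*} [Ring R] [PartialOrder R] [StarRing R]
    [StarOrderedRing R] {a p q : R} (hp : IsSelfAdjoint p) (hq : 0 ≤ q) (hpq : p * q = 1) :
    a + star a ≤ p + a * q * star a := by
  have hqp : q * p = 1 := by
    simpa only [star_mul, hp.star_eq, (IsSelfAdjoint.of_nonneg hq).star_eq, star_one]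
      using congrArg star hpq
  have h : 0 ≤ (p - a) * q * star (p - a) := star_right_conjugate_nonneg hq _
  have hexpand : (p - a) * q * star (p - a) = p + a * q * star a - (a + star a) := by
    rw [star_sub, hp.star_eq]
    simp only [sub_mul, mul_sub, hpq, one_mul, mul_assoc, hqp, mul_one]
    abel
  rwa [hexpand, sub_nonneg] at h

section CStarAlgebra

variable {A : Type*} [CStarAlgebra A] [PartialOrder A] [StarOrderedRing A]

theorem semiconjBy_rpow {x a b : A} (ha : IsStrictlyPositive a) (hb : IsStrictlyPositive b)
    (h : SemiconjBy x a b) (y : ℝ) : SemiconjBy x (a ^ y) (b ^ y) := by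
  rw [CFC.rpow_eq_cfc_real ha.nonneg, CFC.rpow_eq_cfc_real hb.nonneg]
  refine semiconjBy_cfc ha.isSelfAdjoint hb.isSelfAdjoint h
    (by rwa [ha.isSelfAdjoint.star_eq, hb.isSelfAdjoint.star_eq]) fun r hr => ?_
  have hr0 : r ≠ 0 := by
    rintro rfl
    rcases hr with hr | hr
    · exact spectrum.zero_notMem ℝ ha.isUnit hr
    · exact spectrum.zero_notMem ℝ hb.isUnit hr
  exact (Real.continuousAt_rpow_const r y (.inl hr0)).continuousWithinAt

theorem continuousOn_rpow_const_of_nonneg {y : ℝ} (hy : 0 ≤ y) :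
    ContinuousOn (fun a : A => a ^ y) {a | 0 ≤ a} := by
  rcases hy.eq_or_lt with rfl | hy
  · exact continuousOn_const.congr fun a ha => CFC.rpow_zero a ha
  · lift y to NNReal using hy.le
    exact (CFC.continuousOn_nnrpow (A := A) y).congr fun a _ =>
      (CFC.nnrpow_eq_rpow (mod_cast hy)).symm

theorem add_star_le_rpow_add_rpow_of_pos (a : A) (t : ℝ) {ε : ℝ} (hε : 0 < ε) :
    a + star a ≤
      (star a * a + algebraMap ℝ A ε) ^ t + (a * star a + algebraMap ℝ A ε) ^ (1 - t) := by
  set e := algebraMap ℝ A ε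
  have he : IsStrictlyPositive e := isStrictlyPositive_algebraMap hε
  have hC : IsStrictlyPositive (star a * a + e) := he.nonneg_add (star_mul_self_nonneg a)
  have hD : IsStrictlyPositive (a * star a + e) := he.nonneg_add (mul_star_self_nonneg a)
  have hsemi : SemiconjBy a (star a * a + e) (a * star a + e) := by
    have : SemiconjBy a (star a * a) (a * star a) := (mul_assoc a (star a) a).symm
    exact this.add_right (Algebra.commute_algebraMap_right ε a)
  have hpow : (a * star a + e) ^ (-t) * (a * star a + e) = (a * star a + e) ^ (1 - t) := by
    rw [sub_eq_neg_add, CFC.rpow_add hD.isUnit, CFC.rpow_one _ hD.nonneg]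
  calc
    a + star a ≤ (star a * a + e) ^ t + a * (star a * a + e) ^ (-t) * star a :=
      add_star_le_add_mul_mul_star CFC.rpow_nonneg.isSelfAdjoint CFC.rpow_nonneg
        (CFC.rpow_mul_rpow_neg t hC)
    _ = (star a * a + e) ^ t + (a * star a + e) ^ (-t) * (a * star a) := by
      rw [(semiconjBy_rpow hC hD hsemi (-t)).eq, mul_assoc]
    _ ≤ (star a * a + e) ^ t + (a * star a + e) ^ (1 - t) := by
      gcongr
      rw [← hpow, mul_add, le_add_iff_nonneg_right, ← Algebra.commutes, ← Algebra.smul_def]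
      exact smul_nonneg hε.le CFC.rpow_nonneg

theorem add_star_le_rpow_add_rpow (a : A) {t : ℝ} (ht0 : 0 ≤ t) (ht1 : t ≤ 1) :
    a + star a ≤ (star a * a) ^ t + (a * star a) ^ (1 - t) := by
  have hlim {b : A} (hb : 0 ≤ b) {y : ℝ} (hy : 0 ≤ y) :
      Tendsto (fun ε : ℝ => (b + algebraMap ℝ A ε) ^ y) (𝓝[>] 0) (𝓝 (b ^ y)) := by
    have hmaps : ∀ᶠ ε : ℝ in 𝓝[>] 0, 0 ≤ b + algebraMap ℝ A ε := by
      filter_upwards [self_mem_nhdsWithin] with ε hε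
      exact add_nonneg hb (algebraMap_nonneg A (le_of_lt hε))
    have hadd : Tendsto (fun ε : ℝ => b + algebraMap ℝ A ε) (𝓝[>] 0) (𝓝 b) := by
      have : Continuous fun ε : ℝ => b + algebraMap ℝ A ε := by fun_prop
      simpa using (this.tendsto 0).mono_left nhdsWithin_le_nhds
    exact (continuousOn_rpow_const_of_nonneg hy b hb).tendsto.comp
      (tendsto_nhdsWithin_iff.mpr ⟨hadd, hmaps⟩)
  refine ge_of_tendsto ((hlim (star_mul_self_nonneg a) ht0).add
    (hlim (mul_star_self_nonneg a) (sub_nonneg.mpr ht1))) ?_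
  filter_upwards [self_mem_nhdsWithin] with ε hε
  exact add_star_le_rpow_add_rpow_of_pos a t hε

theorem abs_rpow_two_mul (a : A) {s : ℝ} (hs : 0 ≤ s) :
    CFC.abs a ^ (2 * s) = (star a * a) ^ s := by
  rw [← CFC.rpow_rpow_of_exponent_nonneg (CFC.abs a) 2 s zero_le_two hs, ← CFC.abs_sq]
  congr 1
  exact mod_cast CFC.rpow_natCast (CFC.abs a) 2

end CStarAlgebra

theorem two_smul_realPart {A : Type*} [AddCommGroup A] [Module ℂ A] [StarAddMonoid A]
    [StarModule ℂ A] (a : A) : (2 : ℝ) • (ℜ a : A) = a + star a := by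
  rw [realPart_apply_coe, smul_inv_smul₀ two_ne_zero]

theorem realPart_mul_add_mul {A : Type*} [Ring A] [StarRing A] [Algebra ℂ A] [StarModule ℂ A]
    (a : A) {q : A} (hq : IsSelfAdjoint q) :
    (ℜ (a * q + q * a) : A) = ℜ a * q + q * ℜ a := by
  simp only [realPart_apply_coe, star_add, star_mul, hq.star_eq, smul_mul_assoc, mul_smul_comm,
    add_mul, mul_add, ← smul_add]
  congr 1
  abel

theorem norm_add_sq_le_of_isSelfAdjoint {A : Type*} [NonUnitalNormedRing A] [StarRing A]
    [CStarRing A] {a b : A} (h : IsSelfAdjoint (a + b)) :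
    ‖a + b‖ ^ 2 ≤ ‖a‖ ^ 2 + ‖b‖ ^ 2 + ‖a * b + b * a‖ :=
  calc
    ‖a + b‖ ^ 2 = ‖(a + b) * (a + b)‖ := h.norm_mul_self.symm
    _ = ‖a * a + b * b + (a * b + b * a)‖ := by congr 1; noncomm_ring
    _ ≤ ‖a * a‖ + ‖b * b‖ + ‖a * b + b * a‖ := norm_add₃_le
    _ ≤ ‖a‖ ^ 2 + ‖b‖ ^ 2 + ‖a * b + b * a‖ := by
      rw [sq, sq]
      gcongr <;> exact norm_mul_le _ _

section NumericalRadius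

variable {H : Type*} [NormedAddCommGroup H] [InnerProductSpace ℂ H]

theorem numericalRadius_nonneg (T : H →L[ℂ] H) : 0 ≤ numericalRadius T :=
  Real.sSup_nonneg (by rintro _ ⟨x, -, rfl⟩; exact norm_nonneg _)

theorem norm_inner_le_numericalRadius_mul_sq (T : H →L[ℂ] H) (x : H) :
    ‖inner ℂ (T x) x‖ ≤ numericalRadius T * ‖x‖ ^ 2 := by
  rcases eq_or_ne x 0 with rfl | hx
  · simp
  have h := le_csSup (numericalRadius_bddAbove T) ⟨_, norm_smul_inv_norm (𝕜 := ℂ) hx, rfl⟩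
  have hnorm : ‖inner ℂ (T ((‖x‖⁻¹ : ℂ) • x)) ((‖x‖⁻¹ : ℂ) • x)‖ =
      ‖inner ℂ (T x) x‖ / ‖x‖ ^ 2 := by
    simp only [map_smul, inner_smul_left, inner_smul_right, norm_mul, map_inv₀, norm_inv,
      Complex.conj_ofReal, Complex.norm_real, norm_norm]
    field_simp
  exact (div_le_iff₀ (pow_pos (norm_pos_iff.mpr hx) 2)).mp (hnorm.symm.trans_le h)

theorem numericalRadius_circle_smul (c : Circle) (T : H →L[ℂ] H) :
    numericalRadius (c • T) = numericalRadius T := by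
  simp only [numericalRadius, Circle.smul_def, smul_apply, inner_smul_left, norm_mul,
    RCLike.norm_conj, Circle.norm_coe, one_mul]

theorem exists_circle_smul_reApplyInnerSelf_eq_norm (T : H →L[ℂ] H) (x : H) :
    ∃ c : Circle, (c • T).reApplyInnerSelf x = ‖inner ℂ (T x) x‖ := by
  obtain ⟨c, hc, hrot⟩ := RCLike.exists_norm_eq_mul_self (inner ℂ (T x) x)
  obtain ⟨c, rfl⟩ : ∃ u : Circle, (u : ℂ) = c := ⟨⟨c, mem_sphere_zero_iff_norm.mpr hc⟩, rfl⟩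
  refine ⟨c⁻¹, ?_⟩
  rw [ContinuousLinearMap.reApplyInnerSelf_apply, Circle.smul_def, smul_apply, inner_smul_left,
    Circle.coe_inv_eq_conj, Complex.conj_conj, ← hrot]
  exact RCLike.ofReal_re _

theorem reApplyInnerSelf_mono {S T : H →L[ℂ] H} (h : S ≤ T) (x : H) :
    S.reApplyInnerSelf x ≤ T.reApplyInnerSelf x := by
  have hsub := ((ContinuousLinearMap.le_def S T).mp h).re_inner_nonneg_left x
  rwa [sub_apply, inner_sub_left, map_sub, sub_nonneg] at hsub

variable [CompleteSpace H]

theorem reApplyInnerSelf_realPart (T : H →L[ℂ] H) (x : H) :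
    (ℜ T : H →L[ℂ] H).reApplyInnerSelf x = T.reApplyInnerSelf x := by
  have hadj : RCLike.re (inner ℂ (star T x) x) = RCLike.re (inner ℂ (T x) x) := by
    rw [ContinuousLinearMap.star_eq_adjoint, ContinuousLinearMap.adjoint_inner_left, inner_re_symm]
  simp only [ContinuousLinearMap.reApplyInnerSelf_apply, realPart_apply_coe, smul_apply, add_apply,
    inner_smul_left_eq_smul, RCLike.smul_re, inner_add_left, map_add, hadj]
  ring

theorem norm_realPart_le_numericalRadius (T : H →L[ℂ] H) :
    ‖(ℜ T : H →L[ℂ] H)‖ ≤ numericalRadius T := by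
  rw [ContinuousLinearMap.norm_eq_iSup_rayleighQuotient _ (ℜ T).property.isSymmetric]
  refine ciSup_le fun x => ?_
  rw [ContinuousLinearMap.rayleighQuotient, abs_div, abs_sq, reApplyInnerSelf_realPart]
  exact div_le_of_le_mul₀ (sq_nonneg _) (numericalRadius_nonneg T) <|
    (Complex.abs_re_le_norm _).trans (norm_inner_le_numericalRadius_mul_sq T x)

theorem norm_realPart_circle_smul_le_numericalRadius (c : Circle) (T : H →L[ℂ] H) :
    ‖(ℜ (c • T) : H →L[ℂ] H)‖ ≤ numericalRadius T :=
  (norm_realPart_le_numericalRadius (c • T)).trans_eq (numericalRadius_circle_smul c T)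

theorem numericalRadius_le_of_realPart_circle_smul_le {T : H →L[ℂ] H} {r : ℝ} (hr : 0 ≤ r)
    (h : ∀ c : Circle, (ℜ (c • T) : H →L[ℂ] H) ≤ algebraMap ℝ (H →L[ℂ] H) r) :
    numericalRadius T ≤ r := by
  refine Real.sSup_le ?_ hr
  rintro _ ⟨x, hx, rfl⟩
  obtain ⟨c, hc⟩ := exists_circle_smul_reApplyInnerSelf_eq_norm T x
  calc
    ‖inner ℂ (T x) x‖ = (ℜ (c • T) : H →L[ℂ] H).reApplyInnerSelf x := by
      rw [reApplyInnerSelf_realPart, hc]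
    _ ≤ (algebraMap ℝ (H →L[ℂ] H) r).reApplyInnerSelf x := reApplyInnerSelf_mono (h c) x
    _ = r := by
      simp [ContinuousLinearMap.reApplyInnerSelf_apply, Algebra.algebraMap_eq_smul_one,
        inner_smul_left_eq_smul, hx]

theorem numericalRadius_le_of_norm_realPart_circle_smul_le {T : H →L[ℂ] H} {r : ℝ}
    (h : ∀ c : Circle, ‖(ℜ (c • T) : H →L[ℂ] H)‖ ≤ r) : numericalRadius T ≤ r :=
  numericalRadius_le_of_realPart_circle_smul_le ((norm_nonneg _).trans (h 1)) fun c =>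
    (ℜ (c • T)).property.le_algebraMap_norm_self.trans <| algebraMap_mono _ (h c)

variable {Q : H →L[ℂ] H}

theorem realPart_circle_smul_mul_add_mul (c : Circle) (T : H →L[ℂ] H) (hQ : IsSelfAdjoint Q) :
    (ℜ (c • (T * Q + Q * T)) : H →L[ℂ] H) = ℜ (c • T) * Q + Q * ℜ (c • T) := by
  rw [← realPart_mul_add_mul _ hQ, smul_add, smul_mul_assoc, mul_smul_comm]

theorem numericalRadius_mul_add_mul_le (T : H →L[ℂ] H) (hQ : IsSelfAdjoint Q) :
    numericalRadius (T * Q + Q * T) ≤ 2 * (‖Q‖ * numericalRadius T) := by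
  refine numericalRadius_le_of_norm_realPart_circle_smul_le fun c => ?_
  rw [realPart_circle_smul_mul_add_mul c T hQ]
  set R : H →L[ℂ] H := ↑(ℜ (c • T))
  calc
    ‖R * Q + Q * R‖ ≤ ‖R * Q‖ + ‖Q * R‖ := norm_add_le _ _
    _ ≤ ‖R‖ * ‖Q‖ + ‖Q‖ * ‖R‖ := add_le_add (norm_mul_le _ _) (norm_mul_le _ _)
    _ = 2 * (‖Q‖ * ‖R‖) := by ring
    _ ≤ 2 * (‖Q‖ * numericalRadius T) := by
      gcongr
      exact norm_realPart_circle_smul_le_numericalRadius c T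

theorem norm_two_smul_realPart_circle_smul_add_sq_le (c : Circle) (T : H →L[ℂ] H)
    (hQ : IsSelfAdjoint Q) :
    ‖(2 : ℝ) • (ℜ (c • T) : H →L[ℂ] H) + Q‖ ^ 2 ≤
      4 * numericalRadius T ^ 2 + ‖Q‖ ^ 2 + 2 * numericalRadius (T * Q + Q * T) := by
  set R : H →L[ℂ] H := ↑(ℜ (c • T))
  have hR : ‖R‖ ≤ numericalRadius T := norm_realPart_circle_smul_le_numericalRadius c T
  have hRQ : ‖R * Q + Q * R‖ ≤ numericalRadius (T * Q + Q * T) := by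
    rw [← realPart_circle_smul_mul_add_mul c T hQ]
    exact norm_realPart_circle_smul_le_numericalRadius c _
  have hsa : IsSelfAdjoint ((2 : ℝ) • R + Q) :=
    .add (.smul (.all 2) (ℜ (c • T)).property) hQ
  calc
    ‖(2 : ℝ) • R + Q‖ ^ 2
      ≤ ‖(2 : ℝ) • R‖ ^ 2 + ‖Q‖ ^ 2 + ‖((2 : ℝ) • R) * Q + Q * ((2 : ℝ) • R)‖ :=
      norm_add_sq_le_of_isSelfAdjoint hsa
    _ = 4 * ‖R‖ ^ 2 + ‖Q‖ ^ 2 + 2 * ‖R * Q + Q * R‖ := by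
      rw [smul_mul_assoc, mul_smul_comm, ← smul_add, norm_smul, norm_smul, Real.norm_two]
      ring
    _ ≤ 4 * numericalRadius T ^ 2 + ‖Q‖ ^ 2 + 2 * numericalRadius (T * Q + Q * T) := by gcongr

theorem numericalRadius_le_half_norm (hQ : IsSelfAdjoint Q) {T : H →L[ℂ] H}
    (hT : ∀ c : Circle, (2 : ℝ) • (ℜ (c • T) : H →L[ℂ] H) ≤ Q) :
    numericalRadius T ≤ 1 / 2 * ‖Q‖ := by
  refine numericalRadius_le_of_realPart_circle_smul_le (by positivity) fun c => ?_
  set R : H →L[ℂ] H := ↑(ℜ (c • T))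
  calc
    R = (1 / 2 : ℝ) • (2 : ℝ) • R := by module
    _ ≤ (1 / 2 : ℝ) • algebraMap ℝ (H →L[ℂ] H) ‖Q‖ := by
      gcongr
      exact (hT c).trans hQ.le_algebraMap_norm_self
    _ = algebraMap ℝ (H →L[ℂ] H) (1 / 2 * ‖Q‖) := by rw [map_mul, ← Algebra.smul_def]

theorem numericalRadius_le_sqrt (hQ : IsSelfAdjoint Q) {T : H →L[ℂ] H}
    (hT : ∀ c : Circle, (2 : ℝ) • (ℜ (c • T) : H →L[ℂ] H) ≤ Q) :
    numericalRadius T ≤ √(1 / 16 * ‖Q‖ ^ 2 + 1 / 4 * numericalRadius T ^ 2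
      + 1 / 8 * numericalRadius (T * Q + Q * T)) := by
  refine numericalRadius_le_of_realPart_circle_smul_le (Real.sqrt_nonneg _) fun c => ?_
  set R : H →L[ℂ] H := ↑(ℜ (c • T))
  have hsa : IsSelfAdjoint ((2 : ℝ) • R + Q) :=
    .add (.smul (.all 2) (ℜ (c • T)).property) hQ
  have hnorm := norm_two_smul_realPart_circle_smul_add_sq_le c T hQ
  calc
    R = (1 / 4 : ℝ) • ((2 : ℝ) • R + (2 : ℝ) • R) := by module
    _ ≤ (1 / 4 : ℝ) • ((2 : ℝ) • R + Q) := by gcongr; exact hT c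
    _ ≤ (1 / 4 : ℝ) • algebraMap ℝ (H →L[ℂ] H) ‖(2 : ℝ) • R + Q‖ := by
      gcongr
      exact hsa.le_algebraMap_norm_self
    _ = algebraMap ℝ (H →L[ℂ] H) (1 / 4 * ‖(2 : ℝ) • R + Q‖) := by
      rw [map_mul, ← Algebra.smul_def]
    _ ≤ _ := algebraMap_mono _ (Real.le_sqrt_of_sq_le (by linarith))

theorem sqrt_le_norm_add_numericalRadius (hQ : IsSelfAdjoint Q) (T : H →L[ℂ] H) :
    √(1 / 16 * ‖Q‖ ^ 2 + 1 / 4 * numericalRadius T ^ 2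
      + 1 / 8 * numericalRadius (T * Q + Q * T)) ≤ 1 / 4 * ‖Q‖ + 1 / 2 * numericalRadius T := by
  have hw := numericalRadius_nonneg T
  have hTQ := numericalRadius_mul_add_mul_le T hQ
  refine Real.sqrt_le_iff.mpr ⟨by positivity, ?_⟩
  linarith

theorem operatorQ_eq_rpow_add_rpow (T : H →L[ℂ] H) {t : ℝ} (ht0 : 0 ≤ t) (ht1 : t ≤ 1) :
    operatorQ T t = (star T * T) ^ t + (T * star T) ^ (1 - t) := by
  have hstar := abs_rpow_two_mul (star T) (sub_nonneg.mpr ht1)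
  rw [star_star] at hstar
  rw [add_comm, ← hstar, ← abs_rpow_two_mul T ht0]
  rfl

theorem isSelfAdjoint_operatorQ (T : H →L[ℂ] H) (t : ℝ) : IsSelfAdjoint (operatorQ T t) :=
  (CFC.rpow_nonneg (A := H →L[ℂ] H)).isSelfAdjoint.add CFC.rpow_nonneg.isSelfAdjoint

theorem operatorQ_circle_smul (c : Circle) (T : H →L[ℂ] H) (t : ℝ) :
    operatorQ (c • T) t = operatorQ T t := by
  simp only [operatorQ, Circle.smul_def, map_smulₛₗ, CFC.abs_smul, RCLike.norm_conj,
    Circle.norm_coe, one_smul]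

theorem two_smul_realPart_circle_smul_le_operatorQ (c : Circle) (T : H →L[ℂ] H) {t : ℝ}
    (ht0 : 0 ≤ t) (ht1 : t ≤ 1) :
    (2 : ℝ) • (ℜ (c • T) : H →L[ℂ] H) ≤ operatorQ T t := by
  rw [two_smul_realPart, ← operatorQ_circle_smul c, operatorQ_eq_rpow_add_rpow _ ht0 ht1]
  exact add_star_le_rpow_add_rpow _ ht0 ht1

end NumericalRadius

theorem corollary3p4 {H : Type*} [NormedAddCommGroup H] [InnerProductSpace ℂ H] [CompleteSpace H]
    (T : H →L[ℂ] H) (t : ℝ) (ht0 : 0 ≤ t) (ht1 : t ≤ 1) :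
    numericalRadius T ≤
        Real.sqrt ((1 / 16) * ‖operatorQ T t‖ ^ 2 + (1 / 4) * numericalRadius T ^ 2
          + (1 / 8) * numericalRadius (T * operatorQ T t + operatorQ T t * T)) ∧
      Real.sqrt ((1 / 16) * ‖operatorQ T t‖ ^ 2 + (1 / 4) * numericalRadius T ^ 2
          + (1 / 8) * numericalRadius (T * operatorQ T t + operatorQ T t * T)) ≤
        (1 / 4) * ‖operatorQ T t‖ + (1 / 2) * numericalRadius T ∧
      (1 / 4) * ‖operatorQ T t‖ + (1 / 2) * numericalRadius T ≤
        (1 / 2) * ‖operatorQ T t‖ := by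
  have hQ := isSelfAdjoint_operatorQ T t
  have hT (c : Circle) := two_smul_realPart_circle_smul_le_operatorQ c T ht0 ht1
  have hhalf := numericalRadius_le_half_norm hQ hT
  exact ⟨numericalRadius_le_sqrt hQ hT, sqrt_le_norm_add_numericalRadius hQ T, by linarith⟩
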